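/- Let $c_{00}$ be the space of finitely supported real sequences $(x_n)_{n<\omega}$, with canonical basis $(t_n)_{n<\omega}$. For $E\subseteq\omega$ finite let $Ex=\sum_{n\in E}x_nt_n$. The iterates of the Tsirelson norm are $\|x\|_0=\sup_n|x_n|$ and $$\|x\|_{m+1}=\max\Big\{\|x\|_m,\ \tfrac12\sup\Big\{\sum_{i=1}^k\|E_ix\|_m : k\in\omega,\ \emptyset\ne E_1,\dots,E_k\subset\omega \text{ finite},\ k\le\min E_1,\ \max E_i<\min E_{i+1}\Big\}\Big\},$$ and the Tsirelson norm is $\|x\|_T=\lim_m\|x\|_m$. For norms $\|\cdot\|_1,\|\cdot\|_2$ on $c_{00}$ put $$D(\|\cdot\|_1,\|\cdot\|_2)=\sup\{\|x\|_1/\|x\|_2:\|x\|_{\ell^1}=1\}\in(0,\infty],\qquad \varphi(\|\cdot\|_1,\|\cdot\|_2)=1-\frac{\log D}{1+\log D}\in[0,1]\qquad(\star)$$ ($\varphi=0$ if $D=\infty$; $\log D$ is read as $0$ if $D<1$). Let $\mathrm{Str}$ be the set of all structures $(c_{00},\|\cdot\|_{\ell^1},\|\cdot\|)$, $\|\cdot\|$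 a norm on $c_{00}$. Let a logic be given by an arbitrary set of sentences, each identified with the function $\mathrm{Str}\to[0,1]$ giving its truth value, and let $\mathrm{Str}$ carry the topology generated by the basic closed sets $[\sigma]=\{\mathfrak M:\sigma(\mathfrak M)=1\}$, $\sigma$ a sentence. Assume that $\varphi$ is a formula for pairs of structures, i.e. that it is separately continuous on $\mathrm{Str}\times\mathrm{Str}$. Let $\mathcal C\subseteq\mathrm{Str}$ be the class of those structures for which the completion of $(c_{00},\|\cdot\|)$ includes an isomorphic copy of $c_0$ or of $\ell^p$ for some $1\le p<\infty$. For $\mathfrak M,\mathfrak N\in\mathrm{Str}$ let $\mathrm{ltp}_{\mathfrak M}(\mathfrak N)=\varphi(\mathfrak M,\mathfrak N)=\mathrm{rtp}_{\mathfrak N}(\mathfrak M)$, and let $S^l_\varphi(\mathcal C)$, $S^r_\varphi(\mathcal C)$ be the closures of $\{\mathrm{ltp}_{\mathfrak M}|_{\mathcal C}:\mathfrak M\in\mathcal C\}$, $\{\mathrm{rtp}_{\mathfrak N}|_{\mathcal C}:\mathfrak N\in\mathcal C\}$ in $C_p(\mathcal C)$, the space of continuous real-valued functions on $\mathcal C$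 with the topology of pointwise convergence. Then $\|\cdot\|_T$ is uniquely determined by its $\varphi$-type over $\mathcal C$, and that $\varphi$-type is not explicitly definable over $\mathcal C$. Precisely: 1. Every iterate $\|\cdot\|_i$ belongs to $\mathcal C$. For each nonprincipal ultrafilter $\mathcal U$ on $\omega$ the type $t=\lim_{i\to\mathcal U}\mathrm{ltp}_{\|\cdot\|_i}|_{\mathcal C}$ exists in $S^l_\varphi(\mathcal C)$, and a norm $\|\cdot\|_*$ on $c_{00}$ realizes it, i.e. $t=\mathrm{ltp}_{\|\cdot\|_*}|_{\mathcal C}$, if and only if $\|\cdot\|_*=\|\cdot\|_T$. 2. For each nonprincipal ultrafilter $\mathcal U$ on $\omega$ there is exactly one left global $\varphi$-type over $\mathcal C$ given by $(\|\cdot\|_i)_{i<\omega}$ and $\mathcal U$, that is, one function $\tau:S^r_\varphi(\mathcal C)\to[0,1]$ such that $$\tau(t)=\lim_{i\to\mathcal U}\ \lim_{\beta\to\mathcal V}\varphi(\|\cdot\|_i,\mathfrak N_\beta)\quad\text{whenever } t=\lim_{\beta\to\mathcal V}\mathrm{rtp}_{\mathfrak N_\beta}|_{\mathcal C}\in S^r_\varphi(\mathcal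 C),\ \mathfrak N_\beta\in\mathcal C,\ \mathcal V \text{ an ultrafilter},$$ and this $\tau$ is not continuous. No topological assumption on $S^l_\varphi(\mathcal C)$ is made; in particular, the conclusion holds when $S^l_\varphi(\mathcal C)$ is Grothendieck and countably tight. -/

import Mathlib

open Filter Topology
open scoped ENNReal unitInterval

noncomputable section

namespace TsirelsonDef

/-! ### Norms on `c₀₀` -/

/-- `c₀₀`: the real sequences that are eventually `0`. -/
abbrev C00 : Type := ℕ →₀ ℝ

/-- The norm of `ℓ¹`, restricted to `c₀₀`. -/
def ell1 (x : C00) : ℝ := ∑ n ∈ x.support, |x n|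

/-- A norm on `c₀₀`. It is identified with the structure `(c₀₀, ‖·‖_{ℓ¹}, ‖·‖)`. -/
structure C00Norm extends Seminorm ℝ C00 where
  eq_zero_of_map_eq_zero : ∀ x, toFun x = 0 → x = 0

instance : CoeFun C00Norm (fun _ => C00 → ℝ) := ⟨fun N => N.toSeminorm⟩

/-- The vector space `c₀₀`, normed by `N`. -/
def C00Norm.Space (_N : C00Norm) : Type := C00

instance (N : C00Norm) : AddCommGroup N.Space := inferInstanceAs (AddCommGroup C00)
instance (N : C00Norm) : Module ℝ N.Space := inferInstanceAs (Module ℝ C00)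
instance (N : C00Norm) : Norm N.Space := ⟨fun x => N.toSeminorm x⟩

theorem C00Norm.core (N : C00Norm) : NormedSpace.Core ℝ N.Space where
  norm_nonneg x := apply_nonneg N.toSeminorm x
  norm_smul c x := map_smul_eq_mul N.toSeminorm c x
  norm_triangle x y := map_add_le_add N.toSeminorm x y
  norm_eq_zero_iff x := by
    constructor
    · exact fun h => N.eq_zero_of_map_eq_zero x h
    · intro h
      rw [h]
      exact map_zero N.toSeminorm

instance (N : C00Norm) : NormedAddCommGroup N.Space := NormedAddCommGroup.ofCore N.core
instance (N : C00Norm) : NormedSpace ℝ N.Space := NormedSpace.ofCore N.core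

/-- The norm completion of `(c₀₀, N)`, a Banach space. -/
abbrev C00Norm.Compl (N : C00Norm) : Type := UniformSpace.Completion N.Space

/-- `F` includes an isomorphic copy of `E`. -/
def IncludesCopy (E F : Type) [NormedAddCommGroup E] [NormedSpace ℝ E]
    [NormedAddCommGroup F] [NormedSpace ℝ F] : Prop :=
  ∃ f : E →L[ℝ] F, ∃ c : ℝ, 0 < c ∧ ∀ x, c * ‖x‖ ≤ ‖f x‖

/-- The completion of `(c₀₀, N)` includes a copy of `c₀` or of some `ℓᵖ`, `1 ≤ p < ∞`. -/
def IncludesClassical (N : C00Norm) : Prop :=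
  IncludesCopy (ZeroAtInftyContinuousMap ℕ ℝ) N.Compl ∨
    ∃ (p : ℝ≥0∞) (_ : Fact (1 ≤ p)), p ≠ ∞ ∧ IncludesCopy (lp (fun _ : ℕ => ℝ) p) N.Compl

/-! ### The Tsirelson norm -/

/-- The coordinate projection `E x` of `x` onto the finite set `E`. -/
def proj (E : Finset ℕ) (x : C00) : C00 := x.filter (fun n => n ∈ E)

/-- `{k} ≤ E₁ < E₂ < ⋯ < E_k`, for `k` nonempty finite sets of indices. -/
def Admissible (k : ℕ) (E : Fin k → Finset ℕ) : Prop :=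
  (∀ i, (E i).Nonempty) ∧ (∀ i, ∀ n ∈ E i, k ≤ n) ∧
    ∀ i j, i < j → ∀ m ∈ E i, ∀ n ∈ E j, m < n

/-- The sums `∑ᵢ ‖Eᵢ x‖` over all `k` and all `{k} ≤ E₁ < ⋯ < E_k`. -/
def admissibleSums (p : C00 → ℝ) (x : C00) : Set ℝ :=
  {s | ∃ (k : ℕ) (E : Fin k → Finset ℕ), Admissible k E ∧ s = ∑ i, p (proj (E i) x)}

/-- The iterates `‖·‖₀ ≤ ‖·‖₁ ≤ ⋯` of the Tsirelson construction. -/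
def iterFun : ℕ → C00 → ℝ
  | 0 => fun x => ⨆ n, |x n|
  | m + 1 => fun x => max (iterFun m x) (1 / 2 * sSup (admissibleSums (iterFun m) x))

theorem ell1_eq_sum_of_subset {x : C00} {s : Finset ℕ} (h : x.support ⊆ s) :
    ell1 x = ∑ n ∈ s, |x n| := by
  refine Finset.sum_subset h ?_
  intro n _ hn
  simp [Finsupp.notMem_support_iff.1 hn]

theorem abs_le_ell1 (x : C00) (n : ℕ) : |x n| ≤ ell1 x := by
  by_cases h : n ∈ x.support
  · exact Finset.single_le_sum (f := fun n => |x n|) (fun _ _ => abs_nonneg _) h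
  · rw [Finsupp.notMem_support_iff.1 h, abs_zero]
    exact Finset.sum_nonneg fun _ _ => abs_nonneg _

theorem ell1_nonneg (x : C00) : 0 ≤ ell1 x := Finset.sum_nonneg fun _ _ => abs_nonneg _

theorem ell1_proj (E : Finset ℕ) (x : C00) :
    ell1 (proj E x) = ∑ n ∈ x.support, if n ∈ E then |x n| else 0 := by
  rw [ell1_eq_sum_of_subset (s := x.support) (by
    simp only [proj, Finsupp.support_filter]; exact Finset.filter_subset _ _)]
  refine Finset.sum_congr rfl fun n _ => ?_
  simp only [proj, Finsupp.filter_apply]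
  split_ifs <;> simp

theorem sum_ell1_proj_le {k : ℕ} {E : Fin k → Finset ℕ} (hE : Admissible k E) (x : C00) :
    ∑ i, ell1 (proj (E i) x) ≤ ell1 x := by
  simp only [ell1_proj]
  rw [Finset.sum_comm]
  refine Finset.sum_le_sum fun n _ => ?_
  by_cases h : ∃ i, n ∈ E i
  · obtain ⟨i, hi⟩ := h
    rw [Finset.sum_eq_single i]
    · simp [hi]
    · intro j _ hj
      rw [if_neg]
      intro hnj
      rcases lt_or_gt_of_ne hj with h | h
      · exact lt_irrefl _ (hE.2.2 j i h n hnj n hi)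
      · exact lt_irrefl _ (hE.2.2 i j h n hi n hnj)
    · simp
  · push Not at h
    rw [Finset.sum_eq_zero (fun i _ => if_neg (h i))]
    exact abs_nonneg _

theorem admissibleSums_le {p : C00 → ℝ} (hp : ∀ x, p x ≤ ell1 x) {x : C00} {s : ℝ}
    (hs : s ∈ admissibleSums p x) : s ≤ ell1 x := by
  obtain ⟨k, E, hE, rfl⟩ := hs
  exact (Finset.sum_le_sum fun i _ => hp _).trans (sum_ell1_proj_le hE x)

theorem zero_mem_admissibleSums (p : C00 → ℝ) (x : C00) : (0 : ℝ) ∈ admissibleSums p x :=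
  ⟨0, fun i => i.elim0, ⟨fun i => i.elim0, fun i => i.elim0, fun i => i.elim0⟩, by simp⟩

theorem bddAbove_admissibleSums {p : C00 → ℝ} (hp : ∀ x, p x ≤ ell1 x) (x : C00) :
    BddAbove (admissibleSums p x) := ⟨ell1 x, fun _ hs => admissibleSums_le hp hs⟩

theorem proj_add (E : Finset ℕ) (x y : C00) : proj E (x + y) = proj E x + proj E y :=
  Finsupp.filter_add

theorem proj_smul (E : Finset ℕ) (c : ℝ) (x : C00) : proj E (c • x) = c • proj E x :=
  Finsupp.filter_smul

/-- The properties of the iterates that pass from one step to the next. -/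
structure IterProps (p : C00 → ℝ) : Prop where
  le_ell1 : ∀ x, p x ≤ ell1 x
  abs_le : ∀ x n, |x n| ≤ p x
  add_le : ∀ x y, p (x + y) ≤ p x + p y
  smul_le : ∀ (c : ℝ) x, p (c • x) ≤ ‖c‖ * p x

theorem IterProps.nonneg {p : C00 → ℝ} (h : IterProps p) (x : C00) : 0 ≤ p x :=
  (abs_nonneg (x 0)).trans (h.abs_le x 0)

theorem iterProps_step {p : C00 → ℝ} (h : IterProps p) :
    IterProps (fun x => max (p x) (1 / 2 * sSup (admissibleSums p x))) where
  le_ell1 x := by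
    have h1 : sSup (admissibleSums p x) ≤ ell1 x :=
      csSup_le ⟨0, zero_mem_admissibleSums p x⟩ fun s hs => admissibleSums_le h.le_ell1 hs
    have h2 := ell1_nonneg x
    exact max_le (h.le_ell1 x) (by linarith)
  abs_le x n := (h.abs_le x n).trans (le_max_left _ _)
  add_le x y := by
    have key : sSup (admissibleSums p (x + y)) ≤
        sSup (admissibleSums p x) + sSup (admissibleSums p y) := by
      refine csSup_le ⟨0, zero_mem_admissibleSums p _⟩ ?_
      rintro s ⟨k, E, hE, rfl⟩
      have h1 := le_csSup (bddAbove_admissibleSums h.le_ell1 x) ⟨k, E, hE, rfl⟩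
      have h2 := le_csSup (bddAbove_admissibleSums h.le_ell1 y) ⟨k, E, hE, rfl⟩
      have h3 : ∑ i, p (proj (E i) (x + y)) ≤
          ∑ i, p (proj (E i) x) + ∑ i, p (proj (E i) y) := by
        rw [← Finset.sum_add_distrib]
        exact Finset.sum_le_sum fun i _ => by rw [proj_add]; exact h.add_le _ _
      linarith
    refine max_le ((h.add_le x y).trans (add_le_add (le_max_left _ _) (le_max_left _ _))) ?_
    have h1 := le_max_right (p x) (1 / 2 * sSup (admissibleSums p x))
    have h2 := le_max_right (p y) (1 / 2 * sSup (admissibleSums p y))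
    linarith
  smul_le c x := by
    have key : sSup (admissibleSums p (c • x)) ≤ ‖c‖ * sSup (admissibleSums p x) := by
      refine csSup_le ⟨0, zero_mem_admissibleSums p _⟩ ?_
      rintro s ⟨k, E, hE, rfl⟩
      have h1 := le_csSup (bddAbove_admissibleSums h.le_ell1 x) ⟨k, E, hE, rfl⟩
      refine le_trans ?_ (mul_le_mul_of_nonneg_left h1 (norm_nonneg c))
      rw [Finset.mul_sum]
      exact Finset.sum_le_sum fun i _ => by rw [proj_smul]; exact h.smul_le _ _
    rw [mul_max_of_nonneg _ _ (norm_nonneg c)]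
    exact max_le_max (h.smul_le c x) (by linarith)

theorem bddAbove_range_abs (x : C00) : BddAbove (Set.range fun n => |x n|) :=
  ⟨ell1 x, by rintro _ ⟨n, rfl⟩; exact abs_le_ell1 x n⟩

theorem iterProps_iterFun : ∀ m, IterProps (iterFun m)
  | 0 =>
    { le_ell1 := fun x => ciSup_le (abs_le_ell1 x)
      abs_le := fun x n => le_ciSup (bddAbove_range_abs x) n
      add_le := fun x y => ciSup_le fun n =>
        (abs_add_le (x n) (y n)).trans
          (add_le_add (le_ciSup (bddAbove_range_abs x) n) (le_ciSup (bddAbove_range_abs y) n))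
      smul_le := fun c x => ciSup_le fun n => by
        rw [Finsupp.smul_apply, smul_eq_mul, abs_mul]
        exact mul_le_mul_of_nonneg_left (le_ciSup (bddAbove_range_abs x) n) (abs_nonneg c) }
  | m + 1 => iterProps_step (iterProps_iterFun m)

/-- A function with these properties is a norm on `c₀₀`. -/
def IterProps.toNorm {p : C00 → ℝ} (h : IterProps p) : C00Norm where
  toSeminorm := Seminorm.ofSMulLE p
    (le_antisymm ((h.le_ell1 0).trans (by simp [ell1])) (h.nonneg 0)) h.add_le h.smul_le
  eq_zero_of_map_eq_zero x hx := by
    ext n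
    have h1 : |x n| ≤ 0 := (h.abs_le x n).trans (le_of_eq hx)
    simpa using h1

/-- The `m`-th iterate of the Tsirelson norm. -/
def iterNorm (m : ℕ) : C00Norm := (iterProps_iterFun m).toNorm

theorem iterNorm_apply (m : ℕ) (x : C00) : iterNorm m x = iterFun m x := rfl

/-- The Tsirelson norm `‖x‖_T = lim ‖x‖_m = sup ‖x‖_m`, as a function. -/
def tsirelsonFun (x : C00) : ℝ := ⨆ m, iterFun m x

theorem bddAbove_range_iterFun (x : C00) : BddAbove (Set.range fun m => iterFun m x) :=
  ⟨ell1 x, by rintro _ ⟨m, rfl⟩; exact (iterProps_iterFun m).le_ell1 x⟩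

theorem tendsto_iterFun (x : C00) :
    Tendsto (fun m => iterFun m x) atTop (𝓝 (tsirelsonFun x)) :=
  tendsto_atTop_ciSup (monotone_nat_of_le_succ fun _ => le_max_left _ _)
    (bddAbove_range_iterFun x)

theorem iterProps_tsirelsonFun : IterProps tsirelsonFun where
  le_ell1 x := ciSup_le fun m => (iterProps_iterFun m).le_ell1 x
  abs_le x n := ((iterProps_iterFun 0).abs_le x n).trans (le_ciSup (bddAbove_range_iterFun x) 0)
  add_le x y := ciSup_le fun m => ((iterProps_iterFun m).add_le x y).trans
    (add_le_add (le_ciSup (bddAbove_range_iterFun x) m) (le_ciSup (bddAbove_range_iterFun y) m))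
  smul_le c x := ciSup_le fun m => ((iterProps_iterFun m).smul_le c x).trans
    (mul_le_mul_of_nonneg_left (le_ciSup (bddAbove_range_iterFun x) m) (norm_nonneg c))

/-- The Tsirelson norm. -/
def tsirelsonNorm : C00Norm := iterProps_tsirelsonFun.toNorm

/-! ### The formula `(⋆)` -/

/-- `D(M, N) = sup { M x / N x : ‖x‖_{ℓ¹} = 1 }`, possibly `∞`. -/
def normRatio (M N : C00Norm) : ℝ≥0∞ :=
  ⨆ (x : C00) (_ : ell1 x = 1), ENNReal.ofReal (M x / N x)

/-- `1 - L / (1 + L)` with `L = log D`; its value is `0` when `D = ∞`, and `L` is read as `0` when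
`D < 1`, so that the value is always in `[0, 1]`. -/
def starReal (D : ℝ≥0∞) : ℝ :=
  if D = ∞ then 0 else 1 - max (Real.log D.toReal) 0 / (1 + max (Real.log D.toReal) 0)

theorem starReal_mem (D : ℝ≥0∞) : starReal D ∈ I := by
  unfold starReal
  split_ifs
  · simp
  · have h : 0 ≤ max (Real.log D.toReal) 0 := le_max_right _ _
    refine ⟨?_, ?_⟩
    · rw [sub_nonneg, div_le_one (by linarith)]
      linarith
    · have : 0 ≤ max (Real.log D.toReal) 0 / (1 + max (Real.log D.toReal) 0) := by positivity
      linarith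

/-- The formula `(⋆)`, evaluated at the pair of structures `(M, N)`. -/
def starValue (M N : C00Norm) : I := ⟨starReal (normRatio M N), starReal_mem _⟩

/-! ### The space of structures and formulas for pairs of structures -/

/-- The space of structures `(c₀₀, ‖·‖_{ℓ¹}, ‖·‖)` of a logic. A sentence is identified with the
`[0, 1]`-valued function on structures that gives its truth value, and the logic with the set of
its sentences. -/
def Str (_𝓛 : Set (C00Norm → I)) : Type := C00Norm

/-- `M ⊨ s` means that the sentence `s` has the value `1` in `M`; the topology is generated by the
basic closed sets `[s] = {M | M ⊨ s}`. -/
instance (𝓛 : Set (C00Norm → I)) : TopologicalSpace (Str 𝓛) :=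
  TopologicalSpace.generateFrom {U | ∃ s ∈ 𝓛, U = {M : C00Norm | s M = 1}ᶜ}

/-- A formula for pairs of structures: its value is separately continuous. -/
structure PairFormula (S : Type) [TopologicalSpace S] where
  val : S → S → I
  continuous_left : ∀ N, Continuous fun M => val M N
  continuous_right : ∀ M, Continuous fun N => val M N

/-- `C_p(X)`: the continuous real-valued functions, with the topology of pointwise convergence. -/
abbrev Cp (X : Type) [TopologicalSpace X] : Type := {f : X → ℝ // Continuous f}

section Types

variable {S : Type} [TopologicalSpace S] (φ : PairFormula S) (C : Set S)

/-- The left `φ`-type of `M`, restricted to `C`. -/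
def ltp (M : S) : Cp C :=
  ⟨fun N => (φ.val M N : ℝ),
    continuous_subtype_val.comp ((φ.continuous_right M).comp continuous_subtype_val)⟩

/-- The right `φ`-type of `N`, restricted to `C`. -/
def rtp (N : S) : Cp C :=
  ⟨fun M => (φ.val M N : ℝ),
    continuous_subtype_val.comp ((φ.continuous_left N).comp continuous_subtype_val)⟩

/-- The space `S^l_φ(C)` of left `φ`-types over `C`: a closure in `C_p(C)`. -/
def leftTypes : Set (Cp C) := closure (ltp φ C '' C)

/-- The space `S^r_φ(C)` of right `φ`-types over `C`: a closure in `C_p(C)`. -/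
def rightTypes : Set (Cp C) := closure (rtp φ C '' C)

/-- `{ltp_{φ, M i} : i < ω}` determines `M'` uniquely: for each nonprincipal ultrafilter `U` on
`ω`, the type `t = lim_{i → U} ltp_{φ, M i}` over `C` exists, it is realized by `M'`, and by
nothing else. -/
def DeterminesUniquely (M : ℕ → S) (M' : S) : Prop :=
  ∀ U : Ultrafilter ℕ, (U : Filter ℕ) ≤ cofinite →
    ∃ t ∈ leftTypes φ C, Tendsto (fun i => ltp φ C (M i)) U (𝓝 t) ∧
      ∀ M'' : S, ltp φ C M'' = t ↔ M'' = M'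

/-- `τ` is the left global `φ`-type over `C` that is given by the family `M` in `C` and the
ultrafilter `U`: for each type `t = lim_{β → V} rtp_{φ, N β}` in `S^r_φ(C)`,
`τ(t) = lim_{α → U} lim_{β → V} φ(M α, N β)`. -/
def IsLeftGlobalType {κ : Type} (M : κ → S) (U : Ultrafilter κ) (τ : rightTypes φ C → I) : Prop :=
  (∀ α, M α ∈ C) ∧
    ∀ (t : rightTypes φ C) (μ : Type) (N : μ → S) (V : Ultrafilter μ), (∀ β, N β ∈ C) →
      Tendsto (fun β => rtp φ C (N β)) V (𝓝 t.1) →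
        ∃ a : κ → I, (∀ α, Tendsto (fun β => φ.val (M α) (N β)) V (𝓝 (a α))) ∧
          Tendsto a U (𝓝 (τ t))

/-- The left `φ`-type `lim_{α → U} ltp_{φ, M α}` is explicitly definable over `C`: the left global
`φ`-type that is given by `M` and `U` is continuous. -/
def ExplicitlyDefinable {κ : Type} (M : κ → S) (U : Ultrafilter κ) : Prop :=
  ∃ τ : rightTypes φ C → I, IsLeftGlobalType φ C M U τ ∧ Continuous τ

end Types

/-- The class `𝒞` of the structures `(c₀₀, ‖·‖_{ℓ¹}, ‖·‖)` such that the completion of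
`(c₀₀, ‖·‖)` includes `c₀` or some `ℓᵖ`. -/
def classicalClass (𝓛 : Set (C00Norm → I)) : Set (Str 𝓛) := {N | IncludesClassical N}

end TsirelsonDef

end

/-!
The iterates `p₀ ≤ p₁ ≤ ⋯` of the Tsirelson norm `T` increase to `T`, and no `p_{j+1}` is bounded
by a multiple of `p_j`. Everything else is read off from these facts.

*Iterates.* By induction on `m`, the norm `p_m` has a normalized block sequence with an upper `c₀`
estimate (`exists_isC0Block`). The sum of `k` of its blocks beyond `k` is bounded in `p_m`, while
the blocks form an admissible family, so that its `p_{m+1}`-norm is at least `k / 2`; hence there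
are `p_{m+1}`-normalized vectors arbitrarily far out and arbitrarily small in `p_m`
(`IsC0Block.exists_small`). If such vectors get small fast enough, they satisfy an upper
`c₀` estimate in `p_{m+1}` (`isC0Block_succ_of_small`). The lower estimate is automatic,
as coordinate projections do not increase `p_m`; so the completion for each iterate includes `c₀`.

*Uniqueness.* `D(p_i, N)` increases to `D(T, N)`, and the value of `(⋆)` is a continuous function
of `D`, so the left types of the iterates converge to that of `T`. The value of `(⋆)` is `1` if and
only if `M ≤ N`, so a left type over the class determines which of its members dominate the norm.
The class contains all norms equivalent to that of `ℓ¹`, among them `B + ε ‖·‖_{ℓ¹}` for each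
`B ≤ ‖·‖_{ℓ¹}`, and these suffice to recover the norm (`eq_of_starValue_eq`).

*Global type.* The value of the left global type at `t` is the ultralimit of `t(p_i)`. For its
discontinuity, note that separate continuity of `(⋆)` makes
`{M | D(M₀, M) < exp ε and D(M, M₀) < exp ε}` a neighbourhood of `M₀`, however the logic was chosen.
Hence the right types are equicontinuous, their pointwise limits are continuous, and the limit `t`
of the right types of the `p_j` along an ultrafilter is again a right type
(`exists_rightTypes_tendsto`). As `D(p_i, p_j) ≤ 1` for `i ≤ j` and `D(p_i, p_j) = ∞` for `j < i`,
the global type is `1` at `t` and `0` at the type of each `p_j`.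
-/

noncomputable section

namespace TsirelsonDef

/-! ### Block sequences for the iterates of the Tsirelson norm -/

theorem proj_apply (E : Finset ℕ) (x : C00) (n : ℕ) : proj E x n = if n ∈ E then x n else 0 := by
  simp [proj, Finsupp.filter_apply]

theorem proj_comm (E F : Finset ℕ) (x : C00) : proj E (proj F x) = proj F (proj E x) := by
  ext n
  simp only [proj_apply]
  split_ifs <;> rfl

theorem proj_eq_self {E : Finset ℕ} {x : C00} (h : ∀ n ∈ x.support, n ∈ E) : proj E x = x := by
  ext n
  rw [proj_apply]
  split_ifs with hn
  · rfl
  · exact (Finsupp.notMem_support_iff.1 fun hx => hn (h n hx)).symm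

theorem proj_eq_zero {E : Finset ℕ} {x : C00} (h : ∀ n ∈ x.support, n ∉ E) : proj E x = 0 := by
  ext n
  rw [proj_apply, Finsupp.zero_apply]
  split_ifs with hn
  · exact Finsupp.notMem_support_iff.1 fun hx => h n hx hn
  · rfl

theorem proj_sum {ι : Type*} (E : Finset ℕ) (F : Finset ι) (x : ι → C00) :
    proj E (∑ j ∈ F, x j) = ∑ j ∈ F, proj E (x j) := by
  classical
  induction F using Finset.induction_on with
  | empty => simpa using proj_smul E 0 0
  | insert j F hj ih => rw [Finset.sum_insert hj, Finset.sum_insert hj, proj_add, ih]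

theorem sum_proj_le_iterFun_succ (m : ℕ) {k : ℕ} {E : Fin k → Finset ℕ} (hE : Admissible k E)
    (x : C00) : 1 / 2 * ∑ i, iterFun m (proj (E i) x) ≤ iterFun (m + 1) x := by
  refine le_trans ?_ (le_max_right _ _)
  have h := le_csSup (bddAbove_admissibleSums (iterProps_iterFun m).le_ell1 x) ⟨k, E, hE, rfl⟩
  linarith

theorem iterFun_succ_le {m : ℕ} {x : C00} {c : ℝ} (h0 : iterFun m x ≤ c)
    (h : ∀ (k : ℕ) (E : Fin k → Finset ℕ), Admissible k E →
      1 / 2 * ∑ i, iterFun m (proj (E i) x) ≤ c) : iterFun (m + 1) x ≤ c := by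
  have h1 : sSup (admissibleSums (iterFun m) x) ≤ 2 * c := by
    refine csSup_le ⟨0, zero_mem_admissibleSums _ _⟩ ?_
    rintro s ⟨k, E, hE, rfl⟩
    linarith [h k E hE]
  exact max_le h0 (by linarith)

theorem iterFun_le_succ (m : ℕ) (x : C00) : iterFun m x ≤ iterFun (m + 1) x := le_max_left _ _

theorem iterFun_mono (x : C00) : Monotone fun m => iterFun m x :=
  monotone_nat_of_le_succ fun m => iterFun_le_succ m x

theorem iterFun_proj_le (m : ℕ) (F : Finset ℕ) (x : C00) :
    iterFun m (proj F x) ≤ iterFun m x := by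
  induction m generalizing x with
  | zero =>
    refine ciSup_le fun n => le_trans ?_ ((iterProps_iterFun 0).abs_le x n)
    rw [proj_apply]
    split_ifs
    · exact le_rfl
    · simp
  | succ m ih =>
    refine iterFun_succ_le ((ih x).trans (iterFun_le_succ m x)) fun k E hE => ?_
    refine le_trans ?_ (sum_proj_le_iterFun_succ m hE x)
    gcongr with i
    rw [proj_comm]
    exact ih _

theorem iterFun_smul (m : ℕ) (c : ℝ) (x : C00) : iterFun m (c • x) = |c| * iterFun m x :=
  map_smul_eq_mul (iterNorm m).toSeminorm c x

theorem iterFun_zero (m : ℕ) : iterFun m 0 = 0 := map_zero (iterNorm m).toSeminorm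

theorem iterFun_sum_smul_le {ι : Type*} (m : ℕ) (F : Finset ι) (a : ι → ℝ) (x : ι → C00) :
    iterFun m (∑ j ∈ F, a j • x j) ≤ ∑ j ∈ F, |a j| * iterFun m (x j) := by
  classical
  induction F using Finset.induction_on with
  | empty => simp [iterFun_zero]
  | insert j F hj ih =>
    rw [Finset.sum_insert hj, Finset.sum_insert hj, ← iterFun_smul]
    exact ((iterProps_iterFun m).add_le _ _).trans (by linarith)

/-- `x` is a normalized block sequence for the norm `iterFun m` that satisfies an upper `c₀`
estimate with constant `C`. The `j`-th block lives on the interval `[n j, n (j + 1))`. -/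
structure IsC0Block (m : ℕ) (C : ℝ) (n : ℕ → ℕ) (x : ℕ → C00) : Prop where
  strictMono : StrictMono n
  mem_Ico : ∀ j, ∀ i ∈ (x j).support, i ∈ Finset.Ico (n j) (n (j + 1))
  norm_eq : ∀ j, iterFun m (x j) = 1
  upper : ∀ (F : Finset ℕ) (a : ℕ → ℝ) (b : ℝ), 0 ≤ b → (∀ j ∈ F, |a j| ≤ b) →
    iterFun m (∑ j ∈ F, a j • x j) ≤ C * b

namespace IsC0Block

variable {m : ℕ} {C : ℝ} {n : ℕ → ℕ} {x : ℕ → C00}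

theorem proj_block (h : IsC0Block m C n x) (i j : ℕ) :
    proj (Finset.Ico (n i) (n (i + 1))) (x j) = if j = i then x i else 0 := by
  split_ifs with hij
  · subst hij
    exact proj_eq_self (h.mem_Ico j)
  · refine proj_eq_zero fun l hl hl' => ?_
    have h1 := Finset.mem_Ico.1 (h.mem_Ico j l hl)
    have h2 := Finset.mem_Ico.1 hl'
    rcases lt_or_gt_of_ne hij with h3 | h3
    · have := h.strictMono.monotone (Nat.succ_le_of_lt h3)
      simp only [Nat.succ_eq_add_one] at this
      omega
    · have := h.strictMono.monotone (Nat.succ_le_of_lt h3)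
      simp only [Nat.succ_eq_add_one] at this
      omega

theorem proj_sum_block (h : IsC0Block m C n x) (F : Finset ℕ) (a : ℕ → ℝ) {i : ℕ} (hi : i ∈ F) :
    proj (Finset.Ico (n i) (n (i + 1))) (∑ j ∈ F, a j • x j) = a i • x i := by
  rw [proj_sum, Finset.sum_eq_single i]
  · rw [proj_smul, h.proj_block, if_pos rfl]
  · intro j _ hj
    rw [proj_smul, h.proj_block, if_neg hj, smul_zero]
  · exact fun h' => absurd hi h'

theorem lower (h : IsC0Block m C n x) (F : Finset ℕ) (a : ℕ → ℝ) {i : ℕ} (hi : i ∈ F) :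
    |a i| ≤ iterFun m (∑ j ∈ F, a j • x j) := by
  have h1 := iterFun_proj_le m (Finset.Ico (n i) (n (i + 1))) (∑ j ∈ F, a j • x j)
  rwa [h.proj_sum_block F a hi, iterFun_smul, h.norm_eq, mul_one] at h1

/-- A sum of `k` blocks beyond `k` stays bounded in `iterFun m`, but its norm in `iterFun (m + 1)`
is at least `k / 2`; normalized, it is small in `iterFun m`. -/
theorem exists_small (h : IsC0Block m C n x) (N : ℕ) {ε : ℝ} (hε : 0 < ε) :
    ∃ y : C00, (∀ i ∈ y.support, N ≤ i) ∧ iterFun (m + 1) y = 1 ∧ iterFun m y ≤ ε := by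
  obtain ⟨k₀, hk₀⟩ := exists_nat_gt (2 * C / ε)
  set k := max k₀ (max N 1) with hk
  have hk1 : 1 ≤ k := by omega
  have hkpos : (0 : ℝ) < k := by exact_mod_cast hk1
  have hkN : N ≤ k := by omega
  have hkC : 2 * C / ε < k := hk₀.trans_le (by exact_mod_cast le_max_left _ _)
  set F := Finset.Ico k (2 * k) with hF
  set y := ∑ j ∈ F, (1 : ℝ) • x j with hy
  have hup : iterFun m y ≤ C := by
    simpa [hy] using h.upper F (fun _ => 1) 1 zero_le_one (by simp)
  have hlow : (k : ℝ) / 2 ≤ iterFun (m + 1) y := by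
    let E : Fin k → Finset ℕ := fun i => Finset.Ico (n (k + i)) (n (k + i + 1))
    have hE : Admissible k E := by
      refine ⟨fun i => ?_, fun i l hl => ?_, fun i j hij l hl l' hl' => ?_⟩
      · exact Finset.nonempty_Ico.2 (h.strictMono (Nat.lt_succ_self _))
      · have := (Finset.mem_Ico.1 hl).1
        have := h.strictMono.id_le (k + i)
        simp only [id] at this
        omega
      · have h1 := (Finset.mem_Ico.1 hl).2
        have h2 := (Finset.mem_Ico.1 hl').1
        have h3 : n (k + i + 1) ≤ n (k + j) :=
          h.strictMono.monotone (by have : (i : ℕ) < j := hij; omega)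
        omega
    have h1 := sum_proj_le_iterFun_succ m hE y
    have h2 : ∀ i : Fin k, iterFun m (proj (E i) y) = 1 := by
      intro i
      have : k + (i : ℕ) ∈ F := by
        rw [hF, Finset.mem_Ico]
        omega
      simp only [E, hy]
      rw [h.proj_sum_block F (fun _ => 1) this, one_smul, h.norm_eq]
    simp only [h2, Finset.sum_const, Finset.card_univ, Fintype.card_fin, nsmul_eq_mul] at h1
    linarith
  have hpos : 0 < iterFun (m + 1) y := by linarith
  refine ⟨(iterFun (m + 1) y)⁻¹ • y, ?_, ?_, ?_⟩
  · intro i hi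
    have h1 := Finsupp.support_smul hi
    obtain ⟨j, hj, hij⟩ := Finset.mem_biUnion.1 (Finsupp.support_finsetSum h1)
    have h2 := Finset.mem_Ico.1 (h.mem_Ico j i (Finsupp.support_smul hij))
    have h3 := Finset.mem_Ico.1 hj
    have h4 := h.strictMono.id_le j
    simp only [id] at h4
    omega
  · rw [iterFun_smul, abs_of_pos (inv_pos.2 hpos), inv_mul_cancel₀ hpos.ne']
  · rw [iterFun_smul, abs_of_pos (inv_pos.2 hpos), inv_mul_le_iff₀ hpos]
    have h1 : 2 * C < k * ε := (div_lt_iff₀ hε).1 hkC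
    have h2 : (k : ℝ) / 2 * ε ≤ iterFun (m + 1) y * ε := by gcongr
    linarith

end IsC0Block

/-- The canonical basis is a `c₀` block sequence for the supremum norm. -/
theorem isC0Block_zero : IsC0Block 0 1 id fun j => Finsupp.single j 1 where
  strictMono := strictMono_id
  mem_Ico j i hi := by
    have := Finsupp.support_single_subset hi
    rw [Finset.mem_singleton] at this
    simp [this]
  norm_eq j := by
    refine le_antisymm (ciSup_le fun i => ?_) ?_
    · rw [Finsupp.single_apply]
      split_ifs <;> simp
    · simpa using (iterProps_iterFun 0).abs_le (Finsupp.single j 1) j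
  upper F a b hb ha := by
    rw [one_mul]
    refine ciSup_le fun i => ?_
    rw [Finsupp.finsetSum_apply]
    simp only [Finsupp.smul_apply, Finsupp.single_apply, smul_eq_mul, mul_ite, mul_one, mul_zero,
      Finset.sum_ite_eq']
    split_ifs with h
    · exact ha i h
    · simpa using hb

/-- Vectors that are normalized in `iterFun (m + 1)`, live far out and are very small in
`iterFun m` form a `c₀` block sequence: in an admissible sum over `k` sets, at most one block has
`k` in its interval, the earlier blocks do not contribute, and the later blocks are so small that
even `k` times their norms are summable. -/
theorem isC0Block_succ_of_small {m : ℕ} {n : ℕ → ℕ} {y : ℕ → C00} (hn : StrictMono n)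
    (hy : ∀ j, ∀ i ∈ (y j).support, i ∈ Finset.Ico (n j) (n (j + 1)))
    (h1 : ∀ j, iterFun (m + 1) (y j) = 1)
    (hs : ∀ j, (n j + 1) * iterFun m (y j) ≤ (1 / 2) ^ j) : IsC0Block (m + 1) 2 n y where
  strictMono := hn
  mem_Ico := hy
  norm_eq := h1
  upper F a b hb ha := by
    have hnonneg := (iterProps_iterFun m).nonneg
    have hgeom : ∑ j ∈ F, (1 / 2 : ℝ) ^ j ≤ 2 :=
      (summable_geometric_two.sum_le_tsum F fun _ _ => by positivity).trans
        tsum_geometric_two.le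
    have hs' : ∀ j, iterFun m (y j) ≤ (1 / 2) ^ j := fun j => by
      refine le_trans ?_ (hs j)
      have : (0 : ℝ) ≤ n j * iterFun m (y j) := mul_nonneg (Nat.cast_nonneg _) (hnonneg _)
      linarith
    refine iterFun_succ_le ?_ fun k E hE => ?_
    · calc iterFun m (∑ j ∈ F, a j • y j) ≤ ∑ j ∈ F, |a j| * iterFun m (y j) :=
            iterFun_sum_smul_le m F a y
        _ ≤ ∑ j ∈ F, b * (1 / 2) ^ j := by
            refine Finset.sum_le_sum fun j hj => ?_
            exact mul_le_mul (ha j hj) (hs' j) (hnonneg _) hb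
        _ = b * ∑ j ∈ F, (1 / 2 : ℝ) ^ j := by rw [Finset.mul_sum]
        _ ≤ 2 * b := by nlinarith
    · have hblock : ∀ j, ∑ i, iterFun m (proj (E i) (y j)) ≤
          (1 / 2) ^ j + if n j < k ∧ k < n (j + 1) then 2 else 0 := by
        intro j
        rcases le_or_gt k (n j) with hkj | hkj
        · have h2 : ∑ i, iterFun m (proj (E i) (y j)) ≤ k * iterFun m (y j) := by
            calc ∑ i, iterFun m (proj (E i) (y j)) ≤ ∑ _i : Fin k, iterFun m (y j) :=
                  Finset.sum_le_sum fun i _ => iterFun_proj_le m _ _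
              _ = k * iterFun m (y j) := by simp
          have h3 : (k : ℝ) * iterFun m (y j) ≤ (n j + 1) * iterFun m (y j) := by
            have : (k : ℝ) ≤ n j := by exact_mod_cast hkj
            exact mul_le_mul_of_nonneg_right (by linarith) (hnonneg _)
          rw [if_neg (by omega)]
          linarith [hs j]
        · rcases lt_or_ge k (n (j + 1)) with hk' | hk'
          · rw [if_pos ⟨hkj, hk'⟩]
            have h2 := sum_proj_le_iterFun_succ m hE (y j)
            rw [h1 j] at h2
            have : (0 : ℝ) ≤ (1 / 2) ^ j := by positivity
            linarith
          · rw [Finset.sum_eq_zero]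
            · positivity
            · intro i _
              rw [proj_eq_zero, iterFun_zero]
              intro l hl hl'
              have h2 := Finset.mem_Ico.1 (hy j l hl)
              have h3 := hE.2.1 i l hl'
              omega
      have hcard : ∑ j ∈ F, (if n j < k ∧ k < n (j + 1) then (2 : ℝ) else 0) ≤ 2 := by
        rw [← Finset.sum_filter, Finset.sum_const, nsmul_eq_mul]
        have : (F.filter fun j => n j < k ∧ k < n (j + 1)).card ≤ 1 := by
          refine Finset.card_le_one.2 fun i hi j hj => ?_
          have hi := (Finset.mem_filter.1 hi).2
          have hj := (Finset.mem_filter.1 hj).2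
          have h2 : i < j + 1 := hn.lt_iff_lt.1 (hi.1.trans hj.2)
          have h3 : j < i + 1 := hn.lt_iff_lt.1 (hj.1.trans hi.2)
          omega
        have : ((F.filter fun j => n j < k ∧ k < n (j + 1)).card : ℝ) ≤ 1 := by
          exact_mod_cast this
        linarith
      have hsum : ∑ i, iterFun m (proj (E i) (∑ j ∈ F, a j • y j)) ≤
          b * ∑ j ∈ F, ∑ i, iterFun m (proj (E i) (y j)) := by
        calc ∑ i, iterFun m (proj (E i) (∑ j ∈ F, a j • y j))
            ≤ ∑ i, ∑ j ∈ F, b * iterFun m (proj (E i) (y j)) := by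
              refine Finset.sum_le_sum fun i _ => ?_
              rw [proj_sum]
              simp only [proj_smul]
              refine (iterFun_sum_smul_le m F a _).trans (Finset.sum_le_sum fun j hj => ?_)
              exact mul_le_mul_of_nonneg_right (ha j hj) (hnonneg _)
          _ = b * ∑ j ∈ F, ∑ i, iterFun m (proj (E i) (y j)) := by
              rw [Finset.sum_comm, Finset.mul_sum]
              simp only [Finset.mul_sum]
      have htot : ∑ j ∈ F, ∑ i, iterFun m (proj (E i) (y j)) ≤ 4 := by
        refine (Finset.sum_le_sum fun j _ => hblock j).trans ?_
        rw [Finset.sum_add_distrib]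
        linarith
      nlinarith

theorem exists_isC0Block : ∀ m, ∃ C n x, IsC0Block m C n x
  | 0 => ⟨1, id, _, isC0Block_zero⟩
  | m + 1 => by
    obtain ⟨C, n₀, x, hx⟩ := exists_isC0Block m
    have hex : ∀ N : ℕ, ∃ y : C00, (∀ i ∈ y.support, N ≤ i) ∧ iterFun (m + 1) y = 1 ∧
        iterFun m y ≤ (1 / 2) ^ N / (N + 1) := fun N => hx.exists_small N (by positivity)
    choose y hyN hy1 hys using hex
    -- the block that starts at `N` is `y N`, and the next one starts after its support
    let next : ℕ → ℕ := fun N => max N ((y N).support.sup id) + 1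
    let n : ℕ → ℕ := fun j => next^[j] 0
    have hn_succ : ∀ j, n (j + 1) = next (n j) := fun j => Function.iterate_succ_apply' next j 0
    have hn : StrictMono n := strictMono_nat_of_lt_succ fun j => by
      rw [hn_succ]
      exact Nat.lt_succ_of_le (le_max_left _ _)
    refine ⟨2, n, fun j => y (n j), isC0Block_succ_of_small hn (fun j i hi => ?_)
      (fun j => hy1 _) fun j => ?_⟩
    · rw [Finset.mem_Ico, hn_succ]
      refine ⟨hyN _ i hi, Nat.lt_succ_of_le (le_trans ?_ (le_max_right _ _))⟩
      exact Finset.le_sup (f := id) hi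
    · have h1 := hys (n j)
      rw [le_div_iff₀ (by positivity), mul_comm] at h1
      refine h1.trans (pow_le_pow_of_le_one (by norm_num) (by norm_num) ?_)
      exact hn.id_le j

/-- The norms `iterFun (m + 1)` and `iterFun m` are not equivalent. -/
theorem exists_iterFun_le_of_pos (m : ℕ) {ε : ℝ} (hε : 0 < ε) :
    ∃ y : C00, iterFun (m + 1) y = 1 ∧ iterFun m y ≤ ε := by
  obtain ⟨C, n, x, hx⟩ := exists_isC0Block m
  obtain ⟨y, -, hy⟩ := hx.exists_small 0 hε
  exact ⟨y, hy⟩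

/-! ### Copies of `c₀` and `ℓ¹` in completions -/

/-- The canonical map of `c₀₀` into the completion of `(c₀₀, N)`. -/
def C00Norm.toCompl (N : C00Norm) : C00 →ₗ[ℝ] N.Compl :=
  (UniformSpace.Completion.toComplₗᵢ : N.Space →ₗᵢ[ℝ] N.Compl).toLinearMap

theorem C00Norm.norm_toCompl (N : C00Norm) (x : C00) : ‖N.toCompl x‖ = N x :=
  (UniformSpace.Completion.toComplₗᵢ : N.Space →ₗᵢ[ℝ] N.Compl).norm_map x

/-- A space `X` of sequences embeds into `E` if `a ↦ ∑ a j • v j` converges on `X`, with partial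
sums bounded above by a multiple of `‖a‖` and the limit bounded below by one. -/
theorem includesCopy_of_summable {X E : Type} [NormedAddCommGroup X] [NormedSpace ℝ X]
    [NormedAddCommGroup E] [NormedSpace ℝ E] (coord : X →ₗ[ℝ] ℕ → ℝ) (v : ℕ → E) {C c : ℝ}
    (hc : 0 < c) (hsum : ∀ a, Summable fun j => coord a j • v j)
    (hup : ∀ a (F : Finset ℕ), ‖∑ j ∈ F, coord a j • v j‖ ≤ C * ‖a‖)
    (hlow : ∀ a, c * ‖a‖ ≤ ‖∑' j, coord a j • v j‖) : IncludesCopy X E := by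
  let f : X →ₗ[ℝ] E :=
    { toFun := fun a => ∑' j, coord a j • v j
      map_add' := fun a b => by
        rw [← (hsum a).tsum_add (hsum b)]
        simp [add_smul]
      map_smul' := fun r a => by
        rw [RingHom.id_apply, ← (hsum a).tsum_const_smul r]
        simp [mul_smul] }
  refine ⟨f.mkContinuous C fun a => ?_, c, hc, hlow⟩
  exact le_of_tendsto (hsum a).hasSum.norm (Eventually.of_forall (hup a))

/-- The coordinates of a null sequence. -/
def c0Coord : ZeroAtInftyContinuousMap ℕ ℝ →ₗ[ℝ] ℕ → ℝ where
  toFun a := a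
  map_add' _ _ := rfl
  map_smul' _ _ := rfl

theorem abs_c0Coord_le (a : ZeroAtInftyContinuousMap ℕ ℝ) (j : ℕ) : |c0Coord a j| ≤ ‖a‖ := by
  rw [← ZeroAtInftyContinuousMap.norm_toBCF_eq_norm]
  exact a.toBCF.norm_coe_le_norm j

theorem IsC0Block.includesCopy {m : ℕ} {C : ℝ} {n : ℕ → ℕ} {x : ℕ → C00}
    (h : IsC0Block m C n x) :
    IncludesCopy (ZeroAtInftyContinuousMap ℕ ℝ) (iterNorm m).Compl := by
  set N := iterNorm m with hN
  have hnorm : ∀ (F : Finset ℕ) (b : ℕ → ℝ),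
      ‖∑ j ∈ F, b j • N.toCompl (x j)‖ = iterFun m (∑ j ∈ F, b j • x j) := by
    intro F b
    rw [← iterNorm_apply, ← hN, ← N.norm_toCompl, map_sum]
    simp
  have hC : 0 ≤ C := by
    have h1 := h.upper ∅ (fun _ => 0) 1 zero_le_one (by simp)
    rw [Finset.sum_empty, iterFun_zero] at h1
    linarith
  have hsum : ∀ a, Summable fun j => c0Coord a j • N.toCompl (x j) := by
    intro a
    rw [summable_iff_vanishing_norm]
    intro ε hε
    have ha : Tendsto (fun j => c0Coord a j) cofinite (𝓝 0) := by
      have := a.zero_at_infty'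
      rwa [cocompact_eq_cofinite] at this
    have hδ : 0 < ε / (C + 1) := by positivity
    have hev := ha.eventually (Metric.ball_mem_nhds 0 hδ)
    refine ⟨(Filter.eventually_cofinite.1 hev).toFinset, fun F hF => ?_⟩
    rw [hnorm]
    refine lt_of_le_of_lt (h.upper F _ (ε / (C + 1)) hδ.le fun j hj => ?_) ?_
    · by_contra hcon
      refine Finset.disjoint_left.1 hF hj ?_
      rw [Set.Finite.mem_toFinset]
      intro hmem
      rw [dist_zero_right, Real.norm_eq_abs] at hmem
      exact hcon hmem.le
    · rw [mul_div_assoc', div_lt_iff₀ (by linarith)]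
      nlinarith
  refine includesCopy_of_summable c0Coord (fun j => N.toCompl (x j)) (C := C) zero_lt_one hsum
    (fun a F => ?_) fun a => ?_
  · rw [hnorm]
    exact h.upper F _ _ (norm_nonneg a) fun j _ => abs_c0Coord_le a j
  · rw [one_mul, ← ZeroAtInftyContinuousMap.norm_toBCF_eq_norm]
    refine (BoundedContinuousFunction.norm_le (norm_nonneg _)).2 fun i => ?_
    refine ge_of_tendsto (hsum a).hasSum.norm ?_
    filter_upwards [eventually_ge_atTop {i}] with F hF
    rw [hnorm]
    exact h.lower F _ (hF (Finset.mem_singleton_self i))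

theorem includesClassical_iterNorm (m : ℕ) : IncludesClassical (iterNorm m) := by
  obtain ⟨C, n, x, hx⟩ := exists_isC0Block m
  exact Or.inl hx.includesCopy

/-- The coordinates of an absolutely summable sequence. -/
def lpOneCoord : lp (fun _ : ℕ => ℝ) 1 →ₗ[ℝ] ℕ → ℝ where
  toFun a := a
  map_add' _ _ := rfl
  map_smul' _ _ := rfl

theorem hasSum_abs_lpOneCoord (a : lp (fun _ : ℕ => ℝ) 1) :
    HasSum (fun j => |lpOneCoord a j|) ‖a‖ := by
  have h := lp.hasSum_norm (p := 1) (by simp) a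
  exact (by simpa using h : HasSum (fun j => |a j|) ‖a‖)

theorem ell1_sum_single (F : Finset ℕ) (a : ℕ → ℝ) :
    ell1 (∑ j ∈ F, a j • Finsupp.single j 1) = ∑ j ∈ F, |a j| := by
  have happ : ∀ i, (∑ j ∈ F, a j • Finsupp.single j (1 : ℝ)) i = if i ∈ F then a i else 0 := by
    intro i
    rw [Finsupp.finsetSum_apply]
    simp [Finsupp.single_apply]
  rw [ell1_eq_sum_of_subset (s := F)]
  · refine Finset.sum_congr rfl fun i hi => ?_
    rw [happ, if_pos hi]
  · intro i hi
    by_contra hiF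
    rw [Finsupp.mem_support_iff, happ, if_neg hiF] at hi
    exact hi rfl

/-- The completion of a norm equivalent to that of `ℓ¹` includes `ℓ¹`. -/
theorem includesClassical_of_equiv_ell1 (N : C00Norm) {C c : ℝ} (hc : 0 < c)
    (hup : ∀ x, N x ≤ C * ell1 x) (hlow : ∀ x, c * ell1 x ≤ N x) : IncludesClassical N := by
  refine Or.inr ⟨1, inferInstance, ENNReal.one_ne_top, ?_⟩
  have hnorm : ∀ (F : Finset ℕ) (b : ℕ → ℝ),
      ‖∑ j ∈ F, b j • N.toCompl (Finsupp.single j 1)‖ =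
        N (∑ j ∈ F, b j • Finsupp.single j 1) := by
    intro F b
    rw [← N.norm_toCompl, map_sum]
    simp only [map_smul]
  have hC : 0 ≤ C := by
    have h1 := (hlow (Finsupp.single 0 1)).trans (hup _)
    have h2 : ell1 (Finsupp.single 0 1) = 1 := by
      simpa using ell1_sum_single {0} fun _ => 1
    rw [h2] at h1
    linarith
  have hone : ∀ j, ‖N.toCompl (Finsupp.single j 1)‖ ≤ C := by
    intro j
    have h2 : ell1 (Finsupp.single j 1) = 1 := by
      simpa using ell1_sum_single {j} fun _ => 1
    have := hup (Finsupp.single j 1)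
    rwa [h2, mul_one, ← N.norm_toCompl] at this
  have hsum : ∀ a, Summable fun j => lpOneCoord a j • N.toCompl (Finsupp.single j 1) := by
    intro a
    refine Summable.of_norm_bounded ((hasSum_abs_lpOneCoord a).summable.mul_right C) fun j => ?_
    rw [norm_smul, Real.norm_eq_abs]
    exact mul_le_mul_of_nonneg_left (hone j) (abs_nonneg _)
  refine includesCopy_of_summable lpOneCoord _ (C := C) hc hsum (fun a F => ?_) fun a => ?_
  · rw [hnorm]
    refine (hup _).trans (mul_le_mul_of_nonneg_left ?_ hC)
    rw [ell1_sum_single]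
    exact sum_le_hasSum F (fun _ _ => abs_nonneg _) (hasSum_abs_lpOneCoord a)
  · refine le_of_tendsto_of_tendsto ((hasSum_abs_lpOneCoord a).const_mul c)
      (hsum a).hasSum.norm (Eventually.of_forall fun F => ?_)
    simp only
    rw [hnorm]
    refine le_trans ?_ (hlow _)
    rw [ell1_sum_single]

/-! ### The formula `(⋆)` -/

theorem C00Norm.ext_apply {M N : C00Norm} (h : ∀ x, M x = N x) : M = N := by
  obtain ⟨p, hp⟩ := M
  obtain ⟨q, hq⟩ := N
  obtain rfl : p = q := Seminorm.ext h
  rfl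

theorem C00Norm.pos (N : C00Norm) {x : C00} (hx : x ≠ 0) : 0 < N x :=
  (apply_nonneg N.toSeminorm x).lt_of_ne fun h => hx (N.eq_zero_of_map_eq_zero x h.symm)

theorem C00Norm.map_smul (N : C00Norm) (c : ℝ) (x : C00) : N (c • x) = |c| * N x :=
  map_smul_eq_mul N.toSeminorm c x

theorem ell1_pos {x : C00} (hx : x ≠ 0) : 0 < ell1 x := by
  obtain ⟨n, hn⟩ := Finsupp.ne_iff.1 hx
  exact (abs_pos.2 hn).trans_le (abs_le_ell1 x n)

theorem ell1_smul (c : ℝ) (x : C00) : ell1 (c • x) = |c| * ell1 x := by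
  rw [ell1_eq_sum_of_subset (Finsupp.support_smul (b := c) (g := x)), ell1, Finset.mul_sum]
  simp [abs_mul]

theorem ell1_add_le (x y : C00) : ell1 (x + y) ≤ ell1 x + ell1 y := by
  classical
  rw [ell1_eq_sum_of_subset (Finsupp.support_add (g₁ := x) (g₂ := y)),
    ell1_eq_sum_of_subset (x := x) Finset.subset_union_left,
    ell1_eq_sum_of_subset (x := y) Finset.subset_union_right, ← Finset.sum_add_distrib]
  exact Finset.sum_le_sum fun n _ => abs_add_le _ _

theorem normRatio_le_iff {M N : C00Norm} {c : ℝ} (hc : 0 ≤ c) :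
    normRatio M N ≤ ENNReal.ofReal c ↔ ∀ x, M x ≤ c * N x := by
  constructor
  · intro h x
    rcases eq_or_ne x 0 with rfl | hx
    · have h1 : M 0 = 0 := map_zero M.toSeminorm
      have h2 : N 0 = 0 := map_zero N.toSeminorm
      rw [h1, h2, mul_zero]
    · have he := ell1_pos hx
      have h1 : ell1 ((ell1 x)⁻¹ • x) = 1 := by
        rw [ell1_smul, abs_of_pos (inv_pos.2 he), inv_mul_cancel₀ he.ne']
      have h2 := (le_iSup₂ (f := fun (x : C00) (_ : ell1 x = 1) => ENNReal.ofReal (M x / N x))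
        _ h1).trans h
      rw [ENNReal.ofReal_le_ofReal_iff hc, M.map_smul, N.map_smul,
        mul_div_mul_left _ _ (abs_pos.2 (inv_ne_zero he.ne')).ne', div_le_iff₀ (N.pos hx)] at h2
      exact h2
  · intro h
    refine iSup₂_le fun x hx => ENNReal.ofReal_le_ofReal ?_
    exact div_le_of_le_mul₀ (apply_nonneg _ _) hc (h x)

theorem normRatio_le_one_iff {M N : C00Norm} : normRatio M N ≤ 1 ↔ ∀ x, M x ≤ N x := by
  rw [← ENNReal.ofReal_one, normRatio_le_iff zero_le_one]
  simp

theorem normRatio_le_mul {M M' : C00Norm} {c : ℝ} (hc : 0 ≤ c) (h : ∀ x, M x ≤ c * M' x)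
    (N : C00Norm) : normRatio M N ≤ ENNReal.ofReal c * normRatio M' N := by
  refine iSup₂_le fun x hx => ?_
  calc ENNReal.ofReal (M x / N x) ≤ ENNReal.ofReal (c * (M' x / N x)) := by
        refine ENNReal.ofReal_le_ofReal ?_
        rw [← mul_div_assoc]
        exact div_le_div_of_nonneg_right (h x) (apply_nonneg _ _)
    _ = ENNReal.ofReal c * ENNReal.ofReal (M' x / N x) := ENNReal.ofReal_mul hc
    _ ≤ ENNReal.ofReal c * normRatio M' N := by
        gcongr
        exact le_iSup₂ (f := fun (x : C00) (_ : ell1 x = 1) => ENNReal.ofReal (M' x / N x)) x hx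

theorem starReal_of_ne_top {D : ℝ≥0∞} (hD : D ≠ ∞) :
    starReal D = (1 + max (Real.log D.toReal) 0)⁻¹ := by
  have h : 0 < 1 + max (Real.log D.toReal) 0 := by positivity
  rw [starReal, if_neg hD]
  field_simp
  ring

/-- `starReal D = 1 / (1 + max (log D) 0)`, computed in the extended nonnegative reals. -/
theorem starReal_eq (D : ℝ≥0∞) : starReal D = ((1 + (ENNReal.log D).toENNReal)⁻¹).toReal := by
  induction D with
  | top => simp [starReal]
  | coe r =>
    rw [starReal_of_ne_top ENNReal.coe_ne_top]
    rcases eq_or_ne r 0 with rfl | hr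
    · simp
    · rw [ENNReal.log_of_nnreal hr, EReal.toENNReal_of_ne_top (EReal.coe_ne_top _),
        EReal.toReal_coe, ENNReal.toReal_inv, ENNReal.toReal_add ENNReal.one_ne_top
        ENNReal.ofReal_ne_top, ENNReal.toReal_ofReal', ENNReal.coe_toReal, ENNReal.toReal_one]

theorem continuous_starReal : Continuous starReal := by
  have h : Continuous fun D : ℝ≥0∞ => (1 + (ENNReal.log D).toENNReal)⁻¹ :=
    continuous_inv.comp (continuous_const.add
      (EReal.continuous_toENNReal.comp ENNReal.continuous_log))
  rw [funext starReal_eq, continuous_iff_continuousAt]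
  intro D
  refine (ENNReal.continuousAt_toReal ?_).comp h.continuousAt
  simp

theorem starReal_top : starReal ∞ = 0 := by simp [starReal]

theorem starReal_eq_one_iff {D : ℝ≥0∞} : starReal D = 1 ↔ D ≤ 1 := by
  rcases eq_or_ne D ∞ with rfl | hD
  · simp [starReal]
  · rw [starReal_of_ne_top hD, inv_eq_one, add_eq_left, max_eq_right_iff,
      Real.log_nonpos_iff ENNReal.toReal_nonneg, ← ENNReal.toReal_one,
      ENNReal.toReal_le_toReal hD ENNReal.one_ne_top]

theorem le_of_lt_starReal {D : ℝ≥0∞} {ε : ℝ} (hε : 0 < ε) (h : (1 + ε)⁻¹ < starReal D) :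
    D ≤ ENNReal.ofReal (Real.exp ε) := by
  rcases eq_or_ne D ∞ with rfl | hD
  · rw [starReal_top] at h
    exact absurd h (by positivity : (0 : ℝ) ≤ (1 + ε)⁻¹).not_gt
  · rw [starReal_of_ne_top hD, inv_lt_inv₀ (by positivity) (by positivity)] at h
    have h1 : Real.log D.toReal ≤ ε := by
      have := le_max_left (Real.log D.toReal) 0
      linarith
    rw [← ENNReal.ofReal_toReal hD]
    refine ENNReal.ofReal_le_ofReal ?_
    rcases ENNReal.toReal_nonneg.eq_or_lt with h0 | h0
    · rw [← h0]
      positivity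
    · exact (Real.log_le_iff_le_exp h0).1 h1

theorem starReal_le_add {D D' : ℝ≥0∞} {ε : ℝ} (hε : 0 < ε)
    (h : D' ≤ ENNReal.ofReal (Real.exp ε) * D) : starReal D ≤ starReal D' + ε := by
  rcases eq_or_ne D ∞ with rfl | hD
  · rw [starReal_top]
    linarith [(starReal_mem D').1]
  · have hD' : D' ≠ ∞ := ne_top_of_le_ne_top (ENNReal.mul_ne_top ENNReal.ofReal_ne_top hD) h
    have h1 : D'.toReal ≤ Real.exp ε * D.toReal := by
      have := ENNReal.toReal_mono (ENNReal.mul_ne_top ENNReal.ofReal_ne_top hD) h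
      rwa [ENNReal.toReal_mul, ENNReal.toReal_ofReal (Real.exp_pos ε).le] at this
    have hL : max (Real.log D'.toReal) 0 ≤ max (Real.log D.toReal) 0 + ε := by
      have h0 := le_max_right (Real.log D.toReal) 0
      refine max_le ?_ (by linarith)
      rcases ENNReal.toReal_nonneg.eq_or_lt with h2 | h2
      · rw [← h2, Real.log_zero]
        linarith
      · have h3 : 0 < D.toReal := pos_of_mul_pos_right (h2.trans_le h1) (Real.exp_pos ε).le
        have h4 := Real.log_le_log h2 h1
        rw [Real.log_mul (Real.exp_pos ε).ne' h3.ne', Real.log_exp] at h4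
        linarith [le_max_left (Real.log D.toReal) 0]
    rw [starReal_of_ne_top hD, starReal_of_ne_top hD']
    have h0' : 0 ≤ max (Real.log D'.toReal) 0 := le_max_right _ _
    generalize max (Real.log D'.toReal) 0 = L' at *
    have h0 : 0 ≤ max (Real.log D.toReal) 0 := le_max_right _ _
    generalize max (Real.log D.toReal) 0 = L at *
    have h2 : (1 + (L + ε))⁻¹ ≤ (1 + L')⁻¹ := inv_anti₀ (by linarith) (by linarith)
    have h3 : (1 + L)⁻¹ ≤ (1 + (L + ε))⁻¹ + ε := by
      rw [inv_le_iff_one_le_mul₀ (by linarith), add_mul, inv_mul_eq_div]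
      have h4 : (1 + L) / (1 + (L + ε)) = 1 - ε / (1 + (L + ε)) := by
        rw [eq_sub_iff_add_eq, ← add_div]
        exact div_eq_one_iff_eq (by linarith) |>.2 (by ring)
      have h5 : ε / (1 + (L + ε)) ≤ ε := div_le_self hε.le (by linarith)
      have h6 : 0 ≤ ε * L := mul_nonneg hε.le h0
      rw [h4]
      linarith
    linarith

/-- Norms that are `exp ε`-equivalent have left types at distance at most `ε`, uniformly in the
second structure. -/
theorem abs_starValue_sub_le {M M₀ : C00Norm} {ε : ℝ} (hε : 0 < ε)
    (h : normRatio M M₀ ≤ ENNReal.ofReal (Real.exp ε))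
    (h' : normRatio M₀ M ≤ ENNReal.ofReal (Real.exp ε)) (N : C00Norm) :
    |(starValue M N : ℝ) - starValue M₀ N| ≤ ε := by
  have hexp := (Real.exp_pos ε).le
  have h1 : starReal (normRatio M₀ N) ≤ starReal (normRatio M N) + ε :=
    starReal_le_add hε (normRatio_le_mul hexp ((normRatio_le_iff hexp).1 h) N)
  have h2 : starReal (normRatio M N) ≤ starReal (normRatio M₀ N) + ε :=
    starReal_le_add hε (normRatio_le_mul hexp ((normRatio_le_iff hexp).1 h') N)
  rw [abs_le]
  constructor
  · simp only [starValue]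
    linarith
  · simp only [starValue]
    linarith

theorem starValue_eq_one_iff {M N : C00Norm} : starValue M N = 1 ↔ ∀ x, M x ≤ N x := by
  rw [← normRatio_le_one_iff, ← starReal_eq_one_iff, Subtype.ext_iff]
  rfl

theorem starValue_iterNorm_of_le {i j : ℕ} (h : i ≤ j) :
    starValue (iterNorm i) (iterNorm j) = 1 :=
  starValue_eq_one_iff.2 fun x => iterFun_mono x h

theorem starValue_iterNorm_of_lt {i j : ℕ} (h : j < i) :
    starValue (iterNorm i) (iterNorm j) = 0 := by
  have htop : normRatio (iterNorm i) (iterNorm j) = ∞ := by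
    by_contra hne
    have hle := (ENNReal.ofReal_toReal hne).ge
    rw [normRatio_le_iff ENNReal.toReal_nonneg] at hle
    set c := (normRatio (iterNorm i) (iterNorm j)).toReal
    have hc : 0 ≤ c := ENNReal.toReal_nonneg
    obtain ⟨y, hy1, hy⟩ := exists_iterFun_le_of_pos j (ε := (c + 1)⁻¹) (by positivity)
    have h1 : 1 ≤ iterFun i y := hy1.symm.le.trans (iterFun_mono y h)
    have h2 : iterFun i y ≤ c * iterFun j y := hle y
    have h3 : c * iterFun j y ≤ c * (c + 1)⁻¹ := by gcongr
    have h4 : c * (c + 1)⁻¹ < 1 := by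
      rw [← div_eq_mul_inv, div_lt_one (by linarith)]
      linarith
    linarith
  apply Subtype.ext
  change starReal _ = 0
  rw [htop, starReal_top]

theorem normRatio_tsirelsonNorm (N : C00Norm) :
    normRatio tsirelsonNorm N = ⨆ i, normRatio (iterNorm i) N := by
  refine le_antisymm (iSup₂_le fun x hx => ?_) (iSup_le fun i => iSup₂_mono fun x _ => ?_)
  · have ht : Tendsto (fun i => ENNReal.ofReal (iterNorm i x / N x)) atTop
        (𝓝 (ENNReal.ofReal (tsirelsonNorm x / N x))) :=
      ENNReal.tendsto_ofReal ((tendsto_iterFun x).div_const _)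
    refine le_of_tendsto ht (Eventually.of_forall fun i => ?_)
    exact (le_iSup₂ (f := fun (x : C00) (_ : ell1 x = 1) =>
      ENNReal.ofReal (iterNorm i x / N x)) x hx).trans
        (le_iSup (fun i => normRatio (iterNorm i) N) i)
  · refine ENNReal.ofReal_le_ofReal (div_le_div_of_nonneg_right ?_ (apply_nonneg _ _))
    exact le_ciSup (bddAbove_range_iterFun x) i

theorem tendsto_starValue_iterNorm (N : C00Norm) :
    Tendsto (fun i => (starValue (iterNorm i) N : ℝ)) atTop (𝓝 (starValue tsirelsonNorm N)) := by
  have hmono : Monotone fun i => normRatio (iterNorm i) N := fun i j hij =>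
    iSup₂_mono fun x _ => ENNReal.ofReal_le_ofReal
      (div_le_div_of_nonneg_right (iterFun_mono x hij) (apply_nonneg _ _))
  have h := tendsto_atTop_iSup hmono
  rw [← normRatio_tsirelsonNorm] at h
  exact (continuous_starReal.tendsto _).comp h

/-! ### Norms equivalent to that of `ℓ¹` separate the norms on `c₀₀` -/

/-- The norm `p + ε ‖·‖_{ℓ¹}`. -/
def addEll1 (p : Seminorm ℝ C00) {ε : ℝ} (hε : 0 < ε) : C00Norm where
  toSeminorm := Seminorm.ofSMulLE (fun x => p x + ε * ell1 x)
    (by simp [ell1]) (fun x y => by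
      have h1 := map_add_le_add p x y
      have h2 := mul_le_mul_of_nonneg_left (ell1_add_le x y) hε.le
      linarith) (fun c x => by
      rw [map_smul_eq_mul, ell1_smul, Real.norm_eq_abs]
      exact le_of_eq (by ring))
  eq_zero_of_map_eq_zero x hx := by
    by_contra hne
    have h1 : p x + ε * ell1 x = 0 := hx
    have h2 := mul_pos hε (ell1_pos hne)
    linarith [apply_nonneg p x]

theorem addEll1_apply (p : Seminorm ℝ C00) {ε : ℝ} (hε : 0 < ε) (x : C00) :
    addEll1 p hε x = p x + ε * ell1 x := rfl

theorem includesClassical_addEll1 {p : Seminorm ℝ C00} (hp : ∀ x, p x ≤ ell1 x) {ε : ℝ}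
    (hε : 0 < ε) : IncludesClassical (addEll1 p hε) := by
  refine includesClassical_of_equiv_ell1 _ (C := 1 + ε) hε (fun x => ?_) fun x => ?_
  · rw [addEll1_apply]
    linarith [hp x]
  · rw [addEll1_apply]
    linarith [apply_nonneg p x]

/-- Two norms with the same left type over the class coincide, if one of them is at most that of
`ℓ¹`: the type determines which members of the class dominate the norm, and `B + ε ‖·‖_{ℓ¹}` is a
member for each `B ≤ ‖·‖_{ℓ¹}`. -/
theorem eq_of_starValue_eq {A B : C00Norm} (hA : ∀ x, A x ≤ ell1 x)
    (h : ∀ N, IncludesClassical N → starValue B N = starValue A N) : B = A := by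
  have hiff : ∀ N, IncludesClassical N → ((∀ x, B x ≤ N x) ↔ ∀ x, A x ≤ N x) := fun N hN => by
    rw [← starValue_eq_one_iff, ← starValue_eq_one_iff, h N hN]
  have hB : ∀ x, B x ≤ ell1 x := by
    have h0 : ∀ x, (0 : Seminorm ℝ C00) x ≤ ell1 x := ell1_nonneg
    have h1 := (hiff _ (includesClassical_addEll1 h0 one_pos)).2 fun x => by
      simpa [addEll1_apply] using hA x
    intro x
    simpa [addEll1_apply] using h1 x
  have hlim : ∀ P Q : C00Norm,
      (∀ (ε : ℝ) (hε : 0 < ε) (x : C00), P x ≤ addEll1 Q.toSeminorm hε x) → ∀ x, P x ≤ Q x := by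
    intro P Q hPQ x
    have ht : Tendsto (fun ε : ℝ => Q x + ε * ell1 x) (𝓝[>] 0) (𝓝 (Q x + 0 * ell1 x)) :=
      ((continuous_const.add (continuous_id.mul continuous_const)).tendsto 0).mono_left
        nhdsWithin_le_nhds
    rw [zero_mul, add_zero] at ht
    exact ge_of_tendsto ht (eventually_mem_nhdsWithin.mono fun ε hε => hPQ ε hε x)
  have hself : ∀ (P : C00Norm) (ε : ℝ) (hε : 0 < ε) (x : C00), P x ≤ addEll1 P.toSeminorm hε x :=
    fun P ε hε x => by
      rw [addEll1_apply]
      linarith [mul_nonneg hε.le (ell1_nonneg x)]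
  refine C00Norm.ext_apply fun x => le_antisymm ?_ ?_
  · exact hlim B A (fun ε hε => (hiff _ (includesClassical_addEll1 hA hε)).2 (hself A ε hε)) x
  · exact hlim A B (fun ε hε => (hiff _ (includesClassical_addEll1 hB hε)).1 (hself B ε hε)) x

/-! ### Types over a class of structures -/

theorem tendsto_cp_iff {X ι : Type} [TopologicalSpace X] {f : ι → Cp X} {l : Filter ι} {g : Cp X} :
    Tendsto f l (𝓝 g) ↔ ∀ x, Tendsto (fun i => (f i).1 x) l (𝓝 (g.1 x)) := by
  rw [tendsto_subtype_rng, tendsto_pi_nhds]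

section GlobalType

variable {S : Type} [TopologicalSpace S] (φ : PairFormula S) (C : Set S)

theorem tendsto_val_of_tendsto_rtp {μ : Type} {N : μ → S} {V : Filter μ} {t : rightTypes φ C}
    (h : Tendsto (fun β => rtp φ C (N β)) V (𝓝 t.1)) {a : S} (ha : a ∈ C) :
    Tendsto (fun β => (φ.val a (N β) : ℝ)) V (𝓝 (t.1.1 ⟨a, ha⟩)) :=
  tendsto_cp_iff.1 h ⟨a, ha⟩

/-- Each right type over `C` is an ultralimit of types of members of `C`. -/
theorem exists_ultrafilter_tendsto_rtp (t : rightTypes φ C) :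
    ∃ V : Ultrafilter C, Tendsto (fun N : C => rtp φ C N) V (𝓝 t.1) := by
  obtain ⟨V, hV, hVt⟩ := mem_closure_iff_ultrafilter.1 t.2
  have hr : Set.range (fun N : C => rtp φ C N) ∈ V := by
    rwa [show Set.range (fun N : C => rtp φ C N) = rtp φ C '' C by
      rw [Set.image_eq_range]]
  have : NeBot (comap (fun N : C => rtp φ C N) V) := comap_neBot_iff.2 fun s hs => by
    obtain ⟨_, hx, N, rfl⟩ := V.nonempty_of_mem (inter_mem hs hr)
    exact ⟨N, hx⟩
  refine ⟨Ultrafilter.of (comap (fun N : C => rtp φ C N) V), ?_⟩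
  exact (tendsto_comap.mono_left (Ultrafilter.of_le _)).trans hVt

/-- A right type takes its values in `[0, 1]`. -/
theorem rightTypes_mem_unitInterval (t : rightTypes φ C) (a : C) : t.1.1 a ∈ I := by
  obtain ⟨V, hV⟩ := exists_ultrafilter_tendsto_rtp φ C t
  exact isClosed_Icc.mem_of_tendsto (tendsto_val_of_tendsto_rtp φ C hV a.2)
    (Eventually.of_forall fun N => (φ.val a N).2)

/-- The left global type that is given by a family in `C` and an ultrafilter exists and is unique:
its value at `t` is the ultralimit of the values of `t` on the family. -/
theorem existsUnique_isLeftGlobalType {κ : Type} {M : κ → S} (hM : ∀ α, M α ∈ C)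
    (U : Ultrafilter κ) : ∃! τ, IsLeftGlobalType φ C M U τ := by
  let b : rightTypes φ C → κ → I := fun t α =>
    ⟨t.1.1 ⟨M α, hM α⟩, rightTypes_mem_unitInterval φ C t _⟩
  refine ⟨fun t => (U.map (b t)).lim, ⟨hM, ?_⟩, ?_⟩
  · intro t μ N V _ hV
    refine ⟨b t, fun α => ?_, (U.map (b t)).le_nhds_lim⟩
    exact tendsto_subtype_rng.2 (tendsto_val_of_tendsto_rtp φ C hV (hM α))
  · intro τ hτ
    funext t
    obtain ⟨V, hV⟩ := exists_ultrafilter_tendsto_rtp φ C t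
    obtain ⟨a, ha, haU⟩ := hτ.2 t C (fun N => N) V (fun N => N.2) hV
    have hab : a = b t := by
      funext α
      refine tendsto_nhds_unique (ha α) ?_
      exact tendsto_subtype_rng.2 (tendsto_val_of_tendsto_rtp φ C hV (hM α))
    rw [hab] at haU
    exact tendsto_nhds_unique haU (U.map (b t)).le_nhds_lim

/-- The right type of a member of `C`. -/
def rtpMem {N : S} (hN : N ∈ C) : rightTypes φ C := ⟨rtp φ C N, subset_closure ⟨N, hN, rfl⟩⟩

theorem IsLeftGlobalType.tendsto_rtpMem {κ : Type} {M : κ → S} {U : Ultrafilter κ}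
    {τ : rightTypes φ C → I} (h : IsLeftGlobalType φ C M U τ) {N : S} (hN : N ∈ C) :
    Tendsto (fun α => φ.val (M α) N) U (𝓝 (τ (rtpMem φ C hN))) := by
  obtain ⟨a, ha, haU⟩ := h.2 (rtpMem φ C hN) Unit (fun _ => N) (pure ()) (fun _ => hN)
    tendsto_const_nhds
  have : a = fun α => φ.val (M α) N := by
    funext α
    exact tendsto_nhds_unique (ha α) tendsto_const_nhds
  rwa [this] at haU

/-- The two iterated limits of `φ` along `M` differ, so the left global type that `M` gives is not
continuous: it is `0` at the right type of each `M j`, but `1` at their limit `t`. -/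
theorem not_explicitlyDefinable {M : ℕ → S} (hM : ∀ i, M i ∈ C)
    {U : Ultrafilter ℕ} (hU : (U : Filter ℕ) ≤ cofinite)
    (h1 : ∀ i j, i ≤ j → φ.val (M i) (M j) = 1) (h0 : ∀ i j, j < i → φ.val (M i) (M j) = 0)
    (t : rightTypes φ C) {V : Ultrafilter ℕ} (hV : (V : Filter ℕ) ≤ cofinite)
    (ht : Tendsto (fun j => rtp φ C (M j)) V (𝓝 t.1)) : ¬ ExplicitlyDefinable φ C M U := by
  rintro ⟨τ, hτ, hcont⟩
  rw [Nat.cofinite_eq_atTop] at hU hV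
  have hτj : ∀ j, τ (rtpMem φ C (hM j)) = 0 := fun j => by
    refine tendsto_nhds_unique (hτ.tendsto_rtpMem φ C (hM j)) ?_
    refine tendsto_const_nhds.congr' (hU ?_)
    filter_upwards [eventually_gt_atTop j] with i hi
    exact (h0 i j hi).symm
  have hτt : τ t = 1 := by
    obtain ⟨a, ha, haU⟩ := hτ.2 t ℕ M V hM ht
    have : a = fun _ => 1 := by
      funext i
      refine tendsto_nhds_unique (ha i) ?_
      refine tendsto_const_nhds.congr' (hV ?_)
      filter_upwards [eventually_ge_atTop i] with j hj
      exact (h1 i j hj).symm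
    rw [this] at haU
    exact tendsto_nhds_unique haU tendsto_const_nhds
  have hlim : Tendsto (fun j => τ (rtpMem φ C (hM j))) V (𝓝 (τ t)) :=
    (hcont.tendsto t).comp (tendsto_subtype_rng.2 ht)
  simp only [hτj, hτt] at hlim
  exact zero_ne_one (tendsto_nhds_unique tendsto_const_nhds hlim)

end GlobalType

/-! ### The formula `(⋆)` on the space of structures -/

section Star

variable {𝓛 : Set (C00Norm → I)} (φ : PairFormula (Str 𝓛))

/-- As `(⋆)` is separately continuous, the topology of structures refines that of the uniform
closeness of norms, and for it the right types are equicontinuous. -/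
theorem eventually_abs_starValue_sub_le (hφ : ∀ M N : Str 𝓛, φ.val M N = starValue M N)
    (M₀ : Str 𝓛) {ε : ℝ} (hε : 0 < ε) :
    ∀ᶠ M : Str 𝓛 in 𝓝 M₀, ∀ N : C00Norm, |(starValue M N : ℝ) - starValue M₀ N| ≤ ε := by
  have hself : (φ.val M₀ M₀ : ℝ) = 1 :=
    congrArg Subtype.val ((hφ M₀ M₀).trans (starValue_eq_one_iff.2 fun _ => le_rfl))
  have hlt : (1 + ε)⁻¹ < (φ.val M₀ M₀ : ℝ) := by
    rw [hself]
    exact inv_lt_one_of_one_lt₀ (by linarith)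
  have hl := ((continuous_subtype_val.comp (φ.continuous_left M₀)).tendsto M₀).eventually_const_lt
    hlt
  have hr := ((continuous_subtype_val.comp (φ.continuous_right M₀)).tendsto M₀).eventually_const_lt
    hlt
  filter_upwards [hl, hr] with M hMl hMr N
  simp only [Function.comp_apply, hφ] at hMl hMr
  exact abs_starValue_sub_le hε (le_of_lt_starReal hε hMl) (le_of_lt_starReal hε hMr) N

/-- By equicontinuity, pointwise ultralimits of right types of members of `C` are continuous, so
they are right types over `C`. -/
theorem exists_rightTypes_tendsto (hφ : ∀ M N : Str 𝓛, φ.val M N = starValue M N)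
    {C : Set (Str 𝓛)} {μ : Type} {N : μ → Str 𝓛} (hN : ∀ β, N β ∈ C) (V : Ultrafilter μ) :
    ∃ t : rightTypes φ C, Tendsto (fun β => rtp φ C (N β)) V (𝓝 t.1) := by
  let f : Str 𝓛 → I := fun M => (V.map fun β => φ.val M (N β)).lim
  have hf : ∀ M, Tendsto (fun β => (φ.val M (N β) : ℝ)) V (𝓝 (f M : ℝ)) := fun M =>
    (continuous_subtype_val.tendsto _).comp (V.map fun β => φ.val M (N β)).le_nhds_lim
  have hcont : Continuous fun M => (f M : ℝ) := by
    rw [continuous_iff_continuousAt]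
    intro M₀
    rw [ContinuousAt, Metric.tendsto_nhds]
    intro ε hε
    filter_upwards [eventually_abs_starValue_sub_le φ hφ M₀ (half_pos hε)] with M hM
    refine lt_of_le_of_lt ?_ (half_lt_self hε)
    rw [Real.dist_eq]
    refine le_of_tendsto ((hf M).sub (hf M₀)).abs (Eventually.of_forall fun β => ?_)
    rw [hφ, hφ]
    exact hM (N β)
  let g : Cp C := ⟨fun M => (f M : ℝ), hcont.comp continuous_subtype_val⟩
  have hg : Tendsto (fun β => rtp φ C (N β)) V (𝓝 g) := tendsto_cp_iff.2 fun M => hf M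
  exact ⟨⟨g, mem_closure_of_tendsto hg (Eventually.of_forall fun β => ⟨N β, hN β, rfl⟩)⟩, hg⟩

theorem determinesUniquely_iterNorm (hφ : ∀ M N : Str 𝓛, φ.val M N = starValue M N) :
    DeterminesUniquely φ (classicalClass 𝓛) iterNorm tsirelsonNorm := by
  intro U hU
  rw [Nat.cofinite_eq_atTop] at hU
  have ht : Tendsto (fun i => ltp φ (classicalClass 𝓛) (iterNorm i)) U
      (𝓝 (ltp φ (classicalClass 𝓛) tsirelsonNorm)) := by
    refine tendsto_cp_iff.2 fun N => ?_
    have hval : ∀ M : C00Norm, (ltp φ (classicalClass 𝓛) M).1 N = starValue M N.1 := fun M =>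
      congrArg Subtype.val (hφ M N.1)
    rw [hval]
    exact ((tendsto_starValue_iterNorm N.1).mono_left hU).congr fun i => (hval _).symm
  refine ⟨ltp φ (classicalClass 𝓛) tsirelsonNorm, ?_, ht, fun M => ⟨fun h => ?_, fun h => ?_⟩⟩
  · exact mem_closure_of_tendsto ht
      (Eventually.of_forall fun i => ⟨iterNorm i, includesClassical_iterNorm i, rfl⟩)
  · refine eq_of_starValue_eq (A := tsirelsonNorm) iterProps_tsirelsonFun.le_ell1 fun N hN => ?_
    have h1 : (φ.val M N : ℝ) = φ.val tsirelsonNorm N :=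
      congrFun (congrArg Subtype.val h) (⟨N, hN⟩ : classicalClass 𝓛)
    exact (hφ M N).symm.trans ((Subtype.ext h1).trans (hφ tsirelsonNorm N))
  · rw [h]

end Star

end TsirelsonDef

end

theorem mainTheorem3 (𝓛 : Set (TsirelsonDef.C00Norm → unitInterval))
    (φ : TsirelsonDef.PairFormula (TsirelsonDef.Str 𝓛))
    (hφ : ∀ M N : TsirelsonDef.Str 𝓛, φ.val M N = TsirelsonDef.starValue M N) :
    (∀ i, (TsirelsonDef.iterNorm i : TsirelsonDef.Str 𝓛) ∈ TsirelsonDef.classicalClass 𝓛) ∧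
    TsirelsonDef.DeterminesUniquely φ (TsirelsonDef.classicalClass 𝓛)
      TsirelsonDef.iterNorm TsirelsonDef.tsirelsonNorm ∧
    ∀ U : Ultrafilter ℕ, (U : Filter ℕ) ≤ Filter.cofinite →
      (∃! τ, TsirelsonDef.IsLeftGlobalType φ (TsirelsonDef.classicalClass 𝓛)
        TsirelsonDef.iterNorm U τ) ∧
      ¬ TsirelsonDef.ExplicitlyDefinable φ (TsirelsonDef.classicalClass 𝓛)
        TsirelsonDef.iterNorm U := by
  have hmem : ∀ i, (TsirelsonDef.iterNorm i : TsirelsonDef.Str 𝓛) ∈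
      TsirelsonDef.classicalClass 𝓛 := TsirelsonDef.includesClassical_iterNorm
  refine ⟨hmem, TsirelsonDef.determinesUniquely_iterNorm φ hφ, fun U hU => ⟨?_, ?_⟩⟩
  · exact TsirelsonDef.existsUnique_isLeftGlobalType φ _ hmem U
  · obtain ⟨t, ht⟩ := TsirelsonDef.exists_rightTypes_tendsto φ hφ hmem U
    refine TsirelsonDef.not_explicitlyDefinable φ _ hmem hU (fun i j hij => ?_)
      (fun i j hij => ?_) t hU ht
    · exact (hφ _ _).trans (TsirelsonDef.starValue_iterNorm_of_le hij)
    · exact (hφ _ _).trans (TsirelsonDef.starValue_iterNorm_of_lt hij)
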